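/- Let $n\ge 0$, let $\Omega\subset\mathbb R^n$ be a bounded open set and let $Y=\prod_{j=1}^n(a_j,b_j)$ with $a_j<b_j$ be the reference cell (for instance $Y=(-\tfrac12,\tfrac12)^n$). For $k\in\mathbb Z^n$ put $\tau_k=(k_1(b_1-a_1),\dots,k_n(b_n-a_n))$. For $\varepsilon>0$ the two-scale transform $T=T_\varepsilon:L^2(\Omega)\to L^2(\Omega\times Y)$ is $$(Tu)(x,y)=\sum_{k:\ \varepsilon(\tau_k+Y)\subset\Omega}\chi_{\varepsilon(\tau_k+Y)}(x)\,u(\varepsilon(\tau_k+y)),$$ and it acts on vector fields componentwise. Let $(\varepsilon_i)_i$ be a family of positive numbers tending to $0$ along a filter (for instance a sequence, or all $\varepsilon\to0^+$), and write $\varepsilon$ for $\varepsilon_i$. Let $u^{\varepsilon}\in H^1(\Omega)$, let $u^0\in H^1(\Omega)$ (so $u^0$ does not depend on $y$), and let $u^1\in L^2(\Omega;H^1_{\mathrm{per}}(Y))$, so that $u^1$ is $Y$-periodic in $y$; gradients are weak gradients. Assume that $$Tu^\varepsilon=u^0+\rho_\varepsilon,\qquad Tu^\varepsilon=u^0+\varepsilon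 u^1+\varepsilon\,y\cdot\nabla_xu^0+\varepsilon r_\varepsilon,$$ where $\rho_\varepsilon$ and $r_\varepsilon$ vanish with $\varepsilon$ in the sense that $\int_{\Omega\times Y}\rho_\varepsilon w\,dx\,dy\to0$ and $\int_{\Omega\times Y}r_\varepsilon w\,dx\,dy\to0$ for every $w$ that is smooth up to the boundary, that is, the restriction of a function in $C^\infty(\mathbb R^n\times\mathbb R^n)$. (This holds in particular if they vanish in the norm of $L^2(\Omega\times Y)$.) Then the following hold. 1. $T(\nabla u^\varepsilon)\in L^2(\Omega\times Y)^n$, and for every vector field $v$ on $\overline\Omega\times\overline Y$ that is smooth up to the boundary (in the same sense) and vanishes on $\partial(\Omega\times Y)$, $$\int_{\Omega\times Y}T(\nabla u^\varepsilon)\cdot v\,dx\,dy=\int_{\Omega\times Y}(\nabla_xu^0+\nabla_yu^1)\cdot v\,dx\,dy+o(1)\qquad(\varepsilon\to0).$$ 2. If moreover $\int_{\Omega\times Y}r_\varepsilon w\,dx\,dy=O(\varepsilon)$ for every such $w$ (with a constant that may depend on $w$), then for every such $v$ the error term $o(1)$ in 1 is $O(\varepsilon)$ (with a constant that may depend on $v$).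 3. If $\nabla u^\varepsilon$ is bounded in $L^2(\Omega)^n$ for all sufficiently small $\varepsilon$ (eventually along the filter), then $T(\nabla u^\varepsilon)$ converges to $\nabla_xu^0+\nabla_yu^1$ weakly in $L^2(\Omega\times Y)^n$. -/

import Mathlib

open MeasureTheory Filter Topology Asymptotics
open scoped ContDiff RealInnerProductSpace

/-- The space `ℝⁿ` with its Euclidean structure. -/
abbrev Eucl (n : ℕ) : Type := EuclideanSpace ℝ (Fin n)

/-- The reference cell `Y = ∏ᵢ (aᵢ, bᵢ)`, an open box. -/
def refCell {n : ℕ} (a b : Fin n → ℝ) : Set (Eucl n) :=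
  {y | ∀ i, a i < y i ∧ y i < b i}

/-- The point of the period lattice of `Y` with integer coordinates `k`. -/
noncomputable def latticePoint {n : ℕ} (a b : Fin n → ℝ) (k : Fin n → ℤ) : Eucl n :=
  WithLp.toLp 2 fun i => (k i : ℝ) * (b i - a i)

/-- The small cell `ε (τ + Y)`, where `τ` is the lattice point with coordinates `k`. -/
def smallCell {n : ℕ} (a b : Fin n → ℝ) (ε : ℝ) (k : Fin n → ℤ) : Set (Eucl n) :=
  (fun y => ε • (latticePoint a b k + y)) '' refCell a b

/-- The index of the small (half-open) cell of size `ε` that contains `x`. -/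
noncomputable def cellIndex {n : ℕ} (a b : Fin n → ℝ) (ε : ℝ) (x : Eucl n) : Fin n → ℤ :=
  fun i => ⌊(x i / ε - a i) / (b i - a i)⌋

open Classical in
/-- The two-scale transform
`(T u)(x, y) = ∑ₖ χ_{ε(τₖ + Y)}(x) u(ε (τₖ + y))`,
the sum being over the small cells that are contained in `Ω`. It acts on scalar functions and
(componentwise) on vector fields. -/
noncomputable def twoScale {n : ℕ} {F : Type*} [Zero F] (Ω : Set (Eucl n)) (a b : Fin n → ℝ)
    (ε : ℝ) (u : Eucl n → F) : Eucl n × Eucl n → F :=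
  fun p =>
    if smallCell a b ε (cellIndex a b ε p.1) ⊆ Ω then
      u (ε • (latticePoint a b (cellIndex a b ε p.1) + p.2))
    else 0

/-- `g` is the weak gradient of `f` on the open set `U`. -/
def HasWeakGradOn {n : ℕ} (U : Set (Eucl n)) (f : Eucl n → ℝ) (g : Eucl n → Eucl n) : Prop :=
  LocallyIntegrableOn f U volume ∧ LocallyIntegrableOn g U volume ∧
    ∀ φ : Eucl n → ℝ, ContDiff ℝ ∞ φ → HasCompactSupport φ → tsupport φ ⊆ U →
      ∀ e : Eucl n, ∫ x in U, f x * fderiv ℝ φ x e = -∫ x in U, ⟪g x, e⟫ * φ x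

/-- `g` is the weak partial gradient `∇_y f` of `f` on the open set `U` of pairs `(x, y)`. -/
def HasWeakGradSndOn {n : ℕ} (U : Set (Eucl n × Eucl n)) (f : Eucl n × Eucl n → ℝ)
    (g : Eucl n × Eucl n → Eucl n) : Prop :=
  LocallyIntegrableOn f U volume ∧ LocallyIntegrableOn g U volume ∧
    ∀ φ : Eucl n × Eucl n → ℝ, ContDiff ℝ ∞ φ → HasCompactSupport φ → tsupport φ ⊆ U →
      ∀ e : Eucl n, ∫ p in U, f p * fderiv ℝ φ p (0, e) = -∫ p in U, ⟪g p, e⟫ * φ p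

/-- `f ∈ H¹(Ω)` with weak gradient `g`. -/
def IsH1With {n : ℕ} (Ω : Set (Eucl n)) (f : Eucl n → ℝ) (g : Eucl n → Eucl n) : Prop :=
  MemLp f 2 (volume.restrict Ω) ∧ MemLp g 2 (volume.restrict Ω) ∧ HasWeakGradOn Ω f g

/-- `f ∈ L²(Ω; H¹_per(Y))` with weak gradient `g = ∇_y f`: the function `f` is `Y`-periodic in `y`,
it is weakly differentiable in `y` on all of `Ω × ℝⁿ` (so across the faces of the cells too), and
`f`, `g` are square integrable on `Ω × Y`. -/
def IsL2H1PerWith {n : ℕ} (Ω : Set (Eucl n)) (a b : Fin n → ℝ) (f : Eucl n × Eucl n → ℝ)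
    (g : Eucl n × Eucl n → Eucl n) : Prop :=
  (∀ x ∈ Ω, ∀ (y : Eucl n) (k : Fin n → ℤ), f (x, y + latticePoint a b k) = f (x, y)) ∧
    MemLp f 2 (volume.restrict (Ω ×ˢ refCell a b)) ∧
    MemLp g 2 (volume.restrict (Ω ×ˢ refCell a b)) ∧
    HasWeakGradSndOn (Ω ×ˢ Set.univ) f g

/-- The functions `r i` on `U` vanish along `l` when they are tested against the functions that
are smooth up to the boundary of `U`. -/
def VanishesTested {n : ℕ} {ι : Type*} (U : Set (Eucl n × Eucl n)) (l : Filter ι)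
    (r : ι → Eucl n × Eucl n → ℝ) : Prop :=
  ∀ w : Eucl n × Eucl n → ℝ, ContDiff ℝ ∞ w →
    Tendsto (fun i => ∫ p in U, r i p * w p) l (𝓝 0)

/-- The functions `r i` on `U` are of order `ε i` along `l` (Landau's big `O`) when they are tested
against the functions that are smooth up to the boundary of `U`. -/
def BigOTested {n : ℕ} {ι : Type*} (U : Set (Eucl n × Eucl n)) (l : Filter ι) (ε : ι → ℝ)
    (r : ι → Eucl n × Eucl n → ℝ) : Prop :=
  ∀ w : Eucl n × Eucl n → ℝ, ContDiff ℝ ∞ w →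
    (fun i => ∫ p in U, r i p * w p) =O[l] ε

/-- The first-order remainder `ε⁻¹ (T u - u⁰ - ε u¹ - ε y · ∇ₓ u⁰)`. -/
noncomputable def firstOrderRemainder {n : ℕ} (Ω : Set (Eucl n)) (a b : Fin n → ℝ) (ε : ℝ)
    (u u0 : Eucl n → ℝ) (Du0 : Eucl n → Eucl n) (u1 : Eucl n × Eucl n → ℝ) :
    Eucl n × Eucl n → ℝ :=
  fun p => ε⁻¹ * (twoScale Ω a b ε u p - u0 p.1 - ε * u1 p - ε * ⟪p.2, Du0 p.1⟫)

/-! For fixed `x` the function `y ↦ (T u)(x, y)` is either zero or a copy of `u` on one small cell,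
rescaled by `y ↦ ε (τ + y)`. Its weak `y`-gradient is therefore `ε T(∇u)`, and integration by parts
gives `∫ T u div_y v = -ε ∫ T(∇u) · v`. Insert the first-order expansion of `T u` and divide by `ε`:
`u⁰` does not depend on `y` and contributes nothing, `y · ∇ₓu⁰` contributes `∇ₓu⁰`, and `u¹`
contributes `∇_y u¹`. What remains is an exact identity (`setIntegral_inner_twoScale_sub_eq`): the
defect of `T(∇u)`, tested against `v`, equals `-∫ r_ε div_y v`. Since `div_y v` is again smooth up
to the boundary, claims 1 and 2 are read off from the hypotheses on `r_ε`.

The delicate point is that `v` only vanishes on the boundary, whereas weak derivatives are defined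
by compactly supported test functions, and the boundary of `Ω` has no regularity.
`setIntegral_mul_fderiv_of_eq_zero_on_frontier` removes the small values of the test function. The
error in its derivative disappears because the derivative is zero almost everywhere on the zero set.

For claim 3, `T` is bounded on `L²` uniformly in `ε` (`eLpNorm_twoScale_le`), so `T(∇u^ε)` is
bounded. Claim 1 covers compactly supported smooth fields, which are total in `L²`, and boundedness
extends the convergence to all of `L²`. -/

/-! ### Integration by parts against functions that only vanish on the boundary -/

section Truncation

variable {E : Type*} [NormedAddCommGroup E] [NormedSpace ℝ E] [FiniteDimensional ℝ E]
  [MeasurableSpace E] [BorelSpace E] {μ : Measure E}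

/-- The zeros of a function at which its derivative does not vanish are countable. -/
theorem countable_setOf_eq_zero_deriv_ne_zero (f : ℝ → ℝ) :
    {t | f t = 0 ∧ deriv f t ≠ 0}.Countable := by
  set S := {t | f t = 0 ∧ deriv f t ≠ 0}
  -- A zero with nonvanishing derivative is an isolated zero, and a discrete subset of the line is
  -- countable.
  have hd : DiscreteTopology S := by
    rw [discreteTopology_subtype_iff]
    rintro t ⟨-, ht⟩
    have hev : ∀ᶠ z in 𝓝[≠] t, f z ≠ 0 :=
      (differentiableAt_of_deriv_ne_zero ht).hasDerivAt.eventually_ne ht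
    rw [← disjoint_iff, disjoint_principal_right]
    filter_upwards [hev] with z hz hzS using hz hzS.1
  exact Set.countable_coe_iff.1 (TopologicalSpace.separableSpace_iff_countable.1 inferInstance)

/-- A derivative of a `C¹` function vanishes almost everywhere on the zero set of the function. -/
theorem ae_fderiv_apply_eq_zero_of_eq_zero [μ.IsAddHaarMeasure] {f : E → ℝ} (hf : ContDiff ℝ 1 f) (e : E) :
    ∀ᵐ x ∂μ, f x = 0 → fderiv ℝ f x e = 0 := by
  have hc : Continuous fun x => fderiv ℝ f x e :=
    (hf.continuous_fderiv one_ne_zero).clm_apply continuous_const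
  have hmeas : MeasurableSet {x | f x = 0 → fderiv ℝ f x e = 0} := by
    have h1 : MeasurableSet {x | f x = 0} :=
      (isClosed_singleton.preimage hf.continuous).measurableSet
    have h2 : MeasurableSet {x | fderiv ℝ f x e = 0} :=
      (isClosed_singleton.preimage hc).measurableSet
    exact h1.imp h2
  -- Fubini along the lines of direction `e`: on each line the exceptional points are countable,
  -- hence null.
  refine ae_mem_of_ae_add_linearMap_mem (LinearMap.toSpanSingleton ℝ E e) volume μ hmeas ?_
  intro y
  have hline (t : ℝ) : deriv (fun s : ℝ => f (y + s • e)) t = fderiv ℝ f (y + t • e) e := by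
    have h1 : HasDerivAt (fun s : ℝ => y + s • e) e t := by
      simpa using ((hasDerivAt_id t).smul_const e).const_add y
    exact (((hf.differentiable one_ne_zero).differentiableAt.hasFDerivAt).comp_hasDerivAt t h1).deriv
  filter_upwards [(countable_setOf_eq_zero_deriv_ne_zero fun s : ℝ => f (y + s • e)).ae_notMem volume]
    with t ht
  simp only [hline, LinearMap.toSpanSingleton_apply] at ht ⊢
  tauto

/-- The auxiliary profile `s ↦ s b(s)` with a bump function `b`, which is the identity near `0`. -/
theorem exists_contDiff_eq_id_near_zero : ∃ ψ : ℝ → ℝ, ContDiff ℝ ∞ ψ ∧ HasCompactSupport ψ ∧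
    ∀ s, |s| ≤ 1 → ψ s = s := by
  let b : ContDiffBump (0 : ℝ) := ⟨1, 2, one_pos, one_lt_two⟩
  refine ⟨fun s => s * b s, contDiff_id.mul b.contDiff, b.hasCompactSupport.mul_left, ?_⟩
  intro s hs
  have : b s = 1 := b.one_of_mem_closedBall (by simpa using hs)
  simp [this]

theorem integrableOn_mul_of_continuous_of_isBounded {U : Set E} (hb : Bornology.IsBounded U)
    (hU : MeasurableSet U)
    {f φ : E → ℝ} (hf : IntegrableOn f U μ) (hφ : Continuous φ) :
    IntegrableOn (fun x => f x * φ x) U μ := by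
  obtain ⟨C, hC⟩ := hb.isCompact_closure.exists_bound_of_continuousOn hφ.continuousOn
  refine Integrable.mul_bdd (c := C) hf hφ.aestronglyMeasurable ?_
  filter_upwards [ae_restrict_mem hU] with x hx using hC x (subset_closure hx)

/-- Integration by parts against compactly supported functions extends to smooth functions which
vanish on the boundary. -/
theorem setIntegral_mul_fderiv_of_eq_zero_on_frontier [μ.IsAddHaarMeasure] {U : Set E} (hU : IsOpen U)
    (hUb : Bornology.IsBounded U) {f g : E → ℝ} {e : E}
    (hf : IntegrableOn f U μ) (hg : IntegrableOn g U μ)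
    (h : ∀ φ : E → ℝ, ContDiff ℝ ∞ φ → HasCompactSupport φ → tsupport φ ⊆ U →
      ∫ x in U, f x * fderiv ℝ φ x e ∂μ = -∫ x in U, g x * φ x ∂μ)
    {φ : E → ℝ} (hφ : ContDiff ℝ ∞ φ) (hφ0 : ∀ x ∈ frontier U, φ x = 0) :
    ∫ x in U, f x * fderiv ℝ φ x e ∂μ = -∫ x in U, g x * φ x ∂μ := by
  obtain ⟨ψ, hψ, hψc, hψ1⟩ := exists_contDiff_eq_id_near_zero
  -- `θ N` vanishes for `|s| ≤ 1 / (N + 1)` and differs from `s` by at most `sup |ψ| / (N + 1)`; its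
  -- derivative is bounded uniformly in `N`.
  let θ : ℕ → ℝ → ℝ := fun N s => s - ψ ((N + 1) * s) / (N + 1)
  let Φ : ℕ → E → ℝ := fun N => U.indicator fun x => θ N (φ x)
  have hpos (N : ℕ) : (0 : ℝ) < N + 1 := by positivity
  have hθ (N) : ContDiff ℝ ∞ (θ N) :=
    contDiff_id.sub ((hψ.comp (contDiff_const.mul contDiff_id)).div_const _)
  have hψ1' : ContDiff ℝ ∞ (deriv ψ) := ((contDiff_infty_iff_deriv).1 hψ).2
  have hθd (N s) : HasDerivAt (θ N) (1 - deriv ψ ((N + 1) * s)) s := by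
    have h1 : HasDerivAt (fun s : ℝ => ((N : ℝ) + 1) * s) ((N : ℝ) + 1) s := by
      simpa using (hasDerivAt_id s).const_mul ((N : ℝ) + 1)
    have h2 := (hψ.differentiable (by simp)).differentiableAt (x := (N + 1) * s) |>.hasDerivAt
    have h3 := (hasDerivAt_id s).sub ((h2.comp s h1).div_const ((N : ℝ) + 1))
    rwa [mul_div_cancel_right₀ _ (hpos N).ne'] at h3
  have hφc := hφ.continuous
  -- At a frontier point `φ` is small nearby, so `θ N` removes it; outside the closure the indicator
  -- does. Hence the extension by zero is smooth and has compact support in `U`.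
  have hnear (N x) (hx : x ∉ U) : Φ N =ᶠ[𝓝 x] 0 := by
    by_cases hxc : x ∈ closure U
    · have hφx : φ x = 0 := hφ0 x (by rw [hU.frontier_eq]; exact ⟨hxc, hx⟩)
      have hev : ∀ᶠ z in 𝓝 x, |(N + 1) * φ z| < 1 := by
        have hcont : Continuous fun z => |((N : ℝ) + 1) * φ z| := by fun_prop
        exact hcont.continuousAt.eventually_lt continuousAt_const (by simp [hφx])
      filter_upwards [hev] with z hz
      by_cases hzU : z ∈ U
      · have := hψ1 _ hz.le
        simp only [Φ, θ, Set.indicator_of_mem hzU, this, Pi.zero_apply]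
        field_simp [(hpos N).ne']
        simp
      · simp [Φ, hzU]
    · filter_upwards [isClosed_closure.isOpen_compl.mem_nhds hxc] with z hz
      have : z ∉ U := fun h => hz (subset_closure h)
      simp [Φ, this]
  have hin (N x) (hx : x ∈ U) : Φ N =ᶠ[𝓝 x] fun z => θ N (φ z) := by
    filter_upwards [hU.mem_nhds hx] with z hz
    simp [Φ, hz]
  have hΦ (N) : ContDiff ℝ ∞ (Φ N) := by
    rw [contDiff_iff_contDiffAt]
    intro x
    by_cases hx : x ∈ U
    · exact (((hθ N).comp hφ).contDiffAt).congr_of_eventuallyEq (hin N x hx)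
    · exact contDiffAt_const.congr_of_eventuallyEq (hnear N x hx)
  have hΦs (N) : tsupport (Φ N) ⊆ U := by
    intro x hx
    by_contra hxU
    exact notMem_tsupport_iff_eventuallyEq.2 (hnear N x hxU) hx
  have hΦc (N) : HasCompactSupport (Φ N) :=
    hUb.isCompact_closure.of_isClosed_subset (isClosed_tsupport _)
      ((hΦs N).trans subset_closure)
  have hΦd (N x) (hx : x ∈ U) :
      fderiv ℝ (Φ N) x e = (1 - deriv ψ ((N + 1) * φ x)) * fderiv ℝ φ x e := by
    rw [(hin N x hx).fderiv_eq]
    have h1 := (hφ.differentiable (by simp)).differentiableAt (x := x) |>.hasFDerivAt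
    have h2 := ((hθd N (φ x)).comp_hasFDerivAt x h1).fderiv
    have h3 : (fun z => θ N (φ z)) = θ N ∘ φ := rfl
    rw [h3, h2]
    simp
  obtain ⟨C, hC⟩ := hψc.exists_bound_of_continuous hψ.continuous
  obtain ⟨C', hC'⟩ := hψc.deriv.exists_bound_of_continuous hψ1'.continuous
  have hφ' : Continuous fun x => fderiv ℝ φ x e :=
    (hφ.continuous_fderiv (by simp)).clm_apply continuous_const
  have hC0 : 0 ≤ C := (norm_nonneg _).trans (hC 0)
  have hlim1 : Tendsto (fun N => ∫ x in U, f x * fderiv ℝ (Φ N) x e ∂μ) atTop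
      (𝓝 (∫ x in U, f x * fderiv ℝ φ x e ∂μ)) := by
    refine tendsto_integral_of_dominated_convergence
      (fun x => (1 + C') * ‖f x * fderiv ℝ φ x e‖) (fun N => ?_) ?_ (fun N => ?_) ?_
    · exact hf.aestronglyMeasurable.mul
        ((((hΦ N).continuous_fderiv (by simp)).clm_apply continuous_const).aestronglyMeasurable)
    · exact (integrableOn_mul_of_continuous_of_isBounded hUb hU.measurableSet hf hφ').norm.const_mul _
    · filter_upwards [ae_restrict_mem hU.measurableSet] with x hx
      rw [hΦd N x hx, mul_left_comm, norm_mul]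
      gcongr
      refine (norm_sub_le _ _).trans ?_
      simpa using hC' _
    -- Where `φ x ≠ 0` the argument of `deriv ψ` leaves its compact support; where `φ x = 0` the
    -- factor `fderiv ℝ φ x e` is zero almost everywhere.
    · filter_upwards [ae_restrict_mem hU.measurableSet,
        ae_restrict_of_ae (ae_fderiv_apply_eq_zero_of_eq_zero (μ := μ) (hφ.of_le (by simp)) e)]
        with x hx hx0
      simp only [hΦd _ x hx]
      by_cases hφx : φ x = 0
      · simp [hx0 hφx]
      · have hlarge : Tendsto (fun N : ℕ => ((N : ℝ) + 1) * φ x) atTop (cocompact ℝ) := by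
          rw [← Metric.cobounded_eq_cocompact, ← tendsto_norm_atTop_iff_cobounded]
          simp only [norm_mul]
          refine Tendsto.atTop_mul_const (norm_pos_iff.2 hφx) ?_
          exact tendsto_norm_atTop_atTop.comp
            (tendsto_atTop_add_const_right _ _ tendsto_natCast_atTop_atTop)
        have hz : Tendsto (fun N : ℕ => deriv ψ ((N + 1) * φ x)) atTop (𝓝 0) :=
          hψc.deriv.is_zero_at_infty.comp hlarge
        simpa using ((hz.const_sub 1).mul_const (fderiv ℝ φ x e)).const_mul (f x)
  have hlim2 : Tendsto (fun N => ∫ x in U, g x * Φ N x ∂μ) atTop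
      (𝓝 (∫ x in U, g x * φ x ∂μ)) := by
    refine tendsto_integral_of_dominated_convergence
      (fun x => ‖g x * φ x‖ + C * ‖g x‖) (fun N => ?_) ?_ (fun N => ?_) ?_
    · exact hg.aestronglyMeasurable.mul (hΦ N).continuous.aestronglyMeasurable
    · exact (integrableOn_mul_of_continuous_of_isBounded hUb hU.measurableSet hg hφc).norm.add
        (hg.norm.const_mul C)
    · filter_upwards [ae_restrict_mem hU.measurableSet] with x hx
      simp only [Φ, Set.indicator_of_mem hx, θ, mul_sub]
      refine (norm_sub_le _ _).trans ?_
      gcongr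
      rw [norm_mul, mul_comm]
      gcongr
      rw [norm_div, Real.norm_of_nonneg (hpos N).le]
      refine (div_le_self (norm_nonneg _) ?_).trans (hC _)
      simp
    · filter_upwards [ae_restrict_mem hU.measurableSet] with x hx
      simp only [Φ, Set.indicator_of_mem hx, θ]
      have hz : Tendsto (fun N : ℕ => ψ ((N + 1) * φ x) / ((N : ℝ) + 1)) atTop (𝓝 0) := by
        refine squeeze_zero_norm (a := fun N : ℕ => C / ((N : ℝ) + 1)) (fun N => ?_) ?_
        · rw [norm_div, Real.norm_of_nonneg (hpos N).le]
          gcongr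
          exact hC _
        · exact tendsto_const_nhds.div_atTop
            (tendsto_atTop_add_const_right _ _ tendsto_natCast_atTop_atTop)
      simpa using (hz.const_sub (φ x)).const_mul (g x)
  refine tendsto_nhds_unique hlim1 ?_
  simp only [fun N => h (Φ N) (hΦ N) (hΦc N) (hΦs N)]
  exact hlim2.neg

end Truncation

/-! ### Geometry of the cells and rescaling -/

section Cells

variable {n : ℕ} {a b : Fin n → ℝ}

theorem isOpen_refCell : IsOpen (refCell a b) := by
  have : refCell a b = ⋂ i, {y : Eucl n | a i < y i ∧ y i < b i} := by
    ext y; simp [refCell]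
  rw [this]
  refine isOpen_iInter_of_finite fun i => ?_
  have hc : Continuous fun y : Eucl n => y i := by fun_prop
  exact (isOpen_lt continuous_const hc).inter (isOpen_lt hc continuous_const)

theorem isCompact_closedCell :
    IsCompact {y : Eucl n | ∀ i, a i ≤ y i ∧ y i ≤ b i} := by
  have h := (isCompact_univ_pi fun i => isCompact_Icc (a := a i) (b := b i)).image
    (PiLp.continuous_toLp 2 fun _ : Fin n => ℝ)
  convert h using 1
  ext y
  constructor
  · intro hy
    exact ⟨fun i => y i, fun i _ => hy i, rfl⟩
  · rintro ⟨z, hz, rfl⟩ i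
    exact hz i trivial

theorem isBounded_refCell : Bornology.IsBounded (refCell a b) :=
  (isCompact_closedCell (a := a) (b := b)).isBounded.subset fun _ hy i =>
    ⟨(hy i).1.le, (hy i).2.le⟩

/-- The homeomorphism `y ↦ ε (τ + y)`, which maps the reference cell onto a small cell. -/
noncomputable def cellHomeomorph (a b : Fin n → ℝ) (k : Fin n → ℤ) {ε : ℝ} (hε : ε ≠ 0) :
    Eucl n ≃ₜ Eucl n :=
  (Homeomorph.addLeft (latticePoint a b k)).trans (Homeomorph.smulOfNeZero ε hε)

variable {k : Fin n → ℤ} {ε : ℝ}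

theorem cellHomeomorph_apply (hε : ε ≠ 0) (y : Eucl n) :
    cellHomeomorph a b k hε y = ε • (latticePoint a b k + y) := rfl

theorem cellHomeomorph_image_refCell (hε : ε ≠ 0) :
    cellHomeomorph a b k hε '' refCell a b = smallCell a b ε k := rfl

theorem cellHomeomorph_preimage_smallCell (hε : ε ≠ 0) :
    cellHomeomorph a b k hε ⁻¹' smallCell a b ε k = refCell a b := by
  rw [← cellHomeomorph_image_refCell hε, Set.preimage_image_eq _ (Homeomorph.injective _)]

theorem measurableSet_smallCell (hε : ε ≠ 0) : MeasurableSet (smallCell a b ε k) := by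
  rw [← cellHomeomorph_image_refCell hε]
  exact ((Homeomorph.isOpenMap _) _ isOpen_refCell).measurableSet

theorem map_cellHomeomorph (hε : ε ≠ 0) :
    (volume : Measure (Eucl n)).map (cellHomeomorph a b k hε) =
      ENNReal.ofReal |(ε ^ n)⁻¹| • volume := by
  have h := Measure.map_addHaar_smul (volume : Measure (Eucl n)) hε
  rw [finrank_euclideanSpace_fin] at h
  rw [← h]
  -- Translation invariance of the volume inserts the shift by the lattice point before the
  -- dilation.
  nth_rw 2 [← map_add_left_eq_self volume (latticePoint a b k)]
  rw [Measure.map_map (by fun_prop) (by fun_prop)]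
  rfl

theorem map_restrict_cellHomeomorph (hε : ε ≠ 0) (s : Set (Eucl n)) :
    (volume.restrict (cellHomeomorph a b k hε ⁻¹' s)).map (cellHomeomorph a b k hε) =
      ENNReal.ofReal |(ε ^ n)⁻¹| • volume.restrict s := by
  rw [← (cellHomeomorph a b k hε).measurableEmbedding.restrict_map, map_cellHomeomorph,
    Measure.restrict_smul]

theorem map_restrict_refCell (hε : ε ≠ 0) :
    (volume.restrict (refCell a b)).map (cellHomeomorph a b k hε) =
      ENNReal.ofReal |(ε ^ n)⁻¹| • volume.restrict (smallCell a b ε k) := by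
  rw [← map_restrict_cellHomeomorph hε, cellHomeomorph_preimage_smallCell]

theorem cellIndex_cellHomeomorph (hab : ∀ j, a j < b j) (hε : ε ≠ 0) (y : Eucl n) (i : Fin n) :
    cellIndex a b ε (cellHomeomorph a b k hε y) i = k i + ⌊(y i - a i) / (b i - a i)⌋ := by
  have hb : b i - a i ≠ 0 := (sub_pos.2 (hab i)).ne'
  simp only [cellIndex, cellHomeomorph_apply, latticePoint, PiLp.smul_apply, PiLp.add_apply,
    smul_eq_mul]
  rw [← Int.floor_intCast_add]
  congr 1
  field_simp
  ring

/-- The half-open version of the reference cell. -/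
def halfOpenCell (a b : Fin n → ℝ) : Set (Eucl n) := {y | ∀ i, a i ≤ y i ∧ y i < b i}

/-- The fibres of `cellIndex` are the rescaled half-open cells. They tile the whole space without a
null set to discard, which makes `T` computable fibre by fibre. -/
theorem cellHomeomorph_preimage_cellIndex (hab : ∀ j, a j < b j) (hε : ε ≠ 0) :
    cellHomeomorph a b k hε ⁻¹' {x | cellIndex a b ε x = k} = halfOpenCell a b := by
  ext y
  simp only [Set.mem_preimage, Set.mem_ofPred_eq, funext_iff, cellIndex_cellHomeomorph hab,
    halfOpenCell]
  refine forall_congr' fun i => ?_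
  have hb : 0 < b i - a i := sub_pos.2 (hab i)
  rw [add_eq_left, Int.floor_eq_zero_iff, Set.mem_Ico, le_div_iff₀ hb, div_lt_iff₀ hb]
  constructor <;> rintro ⟨h1, h2⟩ <;> constructor <;> linarith

theorem volume_halfOpenCell_lt_top : volume (halfOpenCell a b) < ⊤ :=
  (measure_mono fun _ hy i => ⟨(hy i).1, (hy i).2.le⟩).trans_lt
    (isCompact_closedCell (a := a) (b := b)).measure_lt_top

theorem volume_cellIndex_fiber (hab : ∀ j, a j < b j) (hε : ε ≠ 0) :
    ENNReal.ofReal |(ε ^ n)⁻¹| * volume {x | cellIndex a b ε x = k} =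
      volume (halfOpenCell a b) := by
  rw [← cellHomeomorph_preimage_cellIndex hab hε (k := k),
    ← (cellHomeomorph a b k hε).measurableEmbedding.map_apply, map_cellHomeomorph,
    Measure.smul_apply, smul_eq_mul]

theorem measurableSet_cellIndex_fiber : MeasurableSet {x | cellIndex a b ε x = k} := by
  have : Measurable (cellIndex a b ε) := by
    refine measurable_pi_iff.2 fun i => Int.measurable_floor.comp ?_
    fun_prop
  exact this (measurableSet_singleton k)

theorem smallCell_subset_cellIndex_fiber (hab : ∀ j, a j < b j) (hε : ε ≠ 0) :
    smallCell a b ε k ⊆ {x | cellIndex a b ε x = k} := by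
  rw [← cellHomeomorph_image_refCell hε, Set.image_subset_iff,
    cellHomeomorph_preimage_cellIndex hab]
  exact fun _ hy i => ⟨(hy i).1.le, (hy i).2⟩

/-- On a reference cell the rescaled function is weakly differentiable. -/
theorem setIntegral_comp_cellHomeomorph_mul_fderiv (hε : ε ≠ 0) {Ω : Set (Eucl n)}
    (hΩ : MeasurableSet Ω) (hk : smallCell a b ε k ⊆ Ω)
    {u : Eucl n → ℝ} {Du : Eucl n → Eucl n} (hu : HasWeakGradOn Ω u Du) {φ : Eucl n → ℝ}
    (hφ : ContDiff ℝ ∞ φ) (hφc : HasCompactSupport φ) (hφs : tsupport φ ⊆ refCell a b)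
    (e : Eucl n) :
    ∫ y in refCell a b, u (cellHomeomorph a b k hε y) * fderiv ℝ φ y e =
      -∫ y in refCell a b, ε * ⟪Du (cellHomeomorph a b k hε y), e⟫ * φ y := by
  set H := cellHomeomorph a b k hε with hH
  set ψ : Eucl n → ℝ := φ ∘ H.symm with hψdef
  -- Change of variables from `Y` to the small cell, then extension to `Ω`, where the weak gradient
  -- of `u` is available.
  have hint (F : Eucl n → ℝ) (hF : ∀ z ∉ smallCell a b ε k, F z = 0) :
      ∫ y in refCell a b, F (H y) = |(ε ^ n)⁻¹| * ∫ z in Ω, F z := by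
    rw [← H.measurableEmbedding.integral_map, hH, map_restrict_refCell, integral_smul_measure,
      ENNReal.toReal_ofReal (abs_nonneg _), smul_eq_mul,
      setIntegral_eq_of_subset_of_forall_sdiff_eq_zero hΩ hk fun z hz => hF z hz.2]
  have hsymm : ContDiff ℝ ∞ (H.symm : Eucl n → Eucl n) := by
    change ContDiff ℝ ∞ fun z : Eucl n => -latticePoint a b k + ε⁻¹ • z
    fun_prop
  have hψ : ContDiff ℝ ∞ ψ := hφ.comp hsymm
  have hψc : HasCompactSupport ψ := hφc.comp_homeomorph H.symm
  have hψs : tsupport ψ ⊆ smallCell a b ε k := by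
    rw [hψdef, tsupport_comp_eq_preimage, ← cellHomeomorph_image_refCell hε, ← hH]
    intro z hz
    exact ⟨H.symm z, hφs hz, H.apply_symm_apply z⟩
  -- The chain rule for the dilation; this is the origin of the factor `ε` in front of `T(∇u)`.
  have hψd (y : Eucl n) : ε * fderiv ℝ ψ (H y) e = fderiv ℝ φ y e := by
    have hd : HasFDerivAt (H.symm : Eucl n → Eucl n) (ε⁻¹ • ContinuousLinearMap.id ℝ (Eucl n))
        (H y) := by
      change HasFDerivAt (fun z : Eucl n => -latticePoint a b k + ε⁻¹ • z) _ _
      exact ((hasFDerivAt_id (H y)).const_smul ε⁻¹).const_add _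
    have h1 : HasFDerivAt φ (fderiv ℝ φ y) (H.symm (H y)) := by
      rw [H.symm_apply_apply]
      exact (hφ.differentiable (by simp)).differentiableAt.hasFDerivAt
    rw [(h1.comp (H y) hd).fderiv]
    simp [hε]
  have hψy (y : Eucl n) : ψ (H y) = φ y := by simp [hψdef]
  have hψ0 (z) (hz : z ∉ smallCell a b ε k) : z ∉ tsupport ψ := fun h => hz (hψs h)
  have h1 := hint (fun z => ε * (u z * fderiv ℝ ψ z e)) fun z hz => by
    simp [(notMem_tsupport_iff_eventuallyEq.1 (hψ0 z hz)).fderiv_eq]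
  have h2 := hint (fun z => ε * (⟪Du z, e⟫ * ψ z)) fun z hz => by
    simp [image_eq_zero_of_notMem_tsupport (hψ0 z hz)]
  simp only [hψy, integral_const_mul] at h2
  rw [integral_const_mul, integral_const_mul, hu.2.2 ψ hψ hψc (hψs.trans hk) e] at h1
  calc _ = ∫ y in refCell a b, ε * (u (H y) * fderiv ℝ ψ (H y) e) := by
        simp only [← hψd, mul_left_comm]
    _ = _ := by
        simp only [mul_assoc, integral_const_mul]
        rw [h1, h2]; ring

end Cells

/-! ### Measurability and uniform `L²` bound of the two-scale transform -/

section TwoScale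

variable {n : ℕ} {a b : Fin n → ℝ} {ε : ℝ} {F : Type*} [NormedAddCommGroup F]

theorem lintegral_refCell_comp_cellHomeomorph (hε : ε ≠ 0) (k : Fin n → ℤ)
    (g : Eucl n → ENNReal) :
    ∫⁻ y in refCell a b, g (cellHomeomorph a b k hε y) =
      ENNReal.ofReal |(ε ^ n)⁻¹| * ∫⁻ z in smallCell a b ε k, g z := by
  rw [← (cellHomeomorph a b k hε).measurableEmbedding.lintegral_map, map_restrict_refCell,
    lintegral_smul_measure, smul_eq_mul]

theorem aestronglyMeasurable_comp_cellHomeomorph (hε : ε ≠ 0) {k : Fin n → ℤ} {f : Eucl n → F}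
    (hf : AEStronglyMeasurable f (volume.restrict (smallCell a b ε k))) :
    AEStronglyMeasurable (fun y => f (cellHomeomorph a b k hε y))
      (volume.restrict (refCell a b)) := by
  have h := hf.smul_measure (ENNReal.ofReal |(ε ^ n)⁻¹|)
  rw [← map_restrict_refCell hε] at h
  exact (cellHomeomorph a b k hε).measurableEmbedding.aestronglyMeasurable_map_iff.1 h

theorem twoScale_of_subset (hε : ε ≠ 0) {Ω : Set (Eucl n)} {f : Eucl n → F}
    {k : Fin n → ℤ} (hk : smallCell a b ε k ⊆ Ω) {p : Eucl n × Eucl n}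
    (hp : cellIndex a b ε p.1 = k) :
    twoScale Ω a b ε f p = f (cellHomeomorph a b k hε p.2) := by
  subst hp
  exact if_pos hk

theorem twoScale_of_not_subset {Ω : Set (Eucl n)} {f : Eucl n → F}
    {k : Fin n → ℤ} (hk : ¬ smallCell a b ε k ⊆ Ω) {p : Eucl n × Eucl n}
    (hp : cellIndex a b ε p.1 = k) :
    twoScale Ω a b ε f p = 0 := by
  subst hp
  exact if_neg hk

theorem iUnion_cellIndex_fiber_prod (s : Set (Eucl n)) :
    ⋃ k, {x | cellIndex a b ε x = k} ×ˢ s = Set.univ ×ˢ s := by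
  ext p
  simp

theorem aestronglyMeasurable_twoScale (hε : ε ≠ 0) {Ω : Set (Eucl n)} {f : Eucl n → F}
    (hf : AEStronglyMeasurable f (volume.restrict Ω)) :
    AEStronglyMeasurable (twoScale Ω a b ε f) (volume.restrict (Ω ×ˢ refCell a b)) := by
  refine AEStronglyMeasurable.mono_set (t := Set.univ ×ˢ refCell a b)
    (Set.prod_mono_left (Set.subset_univ _)) ?_
  rw [← iUnion_cellIndex_fiber_prod (a := a) (b := b) (ε := ε), aestronglyMeasurable_iUnion_iff]
  intro k
  have hmeas : MeasurableSet ({x | cellIndex a b ε x = k} ×ˢ refCell a b) :=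
    measurableSet_cellIndex_fiber.prod isOpen_refCell.measurableSet
  by_cases hk : smallCell a b ε k ⊆ Ω
  · have h1 := aestronglyMeasurable_comp_cellHomeomorph (a := a) (b := b) hε (hf.mono_set hk)
    have h2 : AEStronglyMeasurable
        (fun p : Eucl n × Eucl n => f (cellHomeomorph a b k hε p.2))
        (volume.restrict ({x | cellIndex a b ε x = k} ×ˢ refCell a b)) := by
      rw [Measure.volume_eq_prod, ← Measure.prod_restrict]
      exact h1.comp_snd
    refine h2.congr ?_
    filter_upwards [ae_restrict_mem hmeas] with p hp
    exact (twoScale_of_subset hε hk hp.1).symm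
  · refine aestronglyMeasurable_const (b := (0 : F)) |>.congr ?_
    filter_upwards [ae_restrict_mem hmeas] with p hp
    exact (twoScale_of_not_subset hk hp.1).symm

/-- Over the fibre of index `k` the integrand depends on `y` only. The volume of the fibre cancels
the Jacobian `ε⁻ⁿ` up to the volume of the reference cell, so the constant is independent of `ε`.
Summing over the disjoint small cells inside `Ω` gives the bound. -/
theorem lintegral_twoScale_le (hab : ∀ j, a j < b j) (hε : ε ≠ 0) {Ω : Set (Eucl n)}
    {f : Eucl n → F} (hf : AEStronglyMeasurable f (volume.restrict Ω)) {q : ℝ} (hq : 0 < q) :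
    ∫⁻ p in Ω ×ˢ refCell a b, ‖twoScale Ω a b ε f p‖ₑ ^ q ≤
      volume (halfOpenCell a b) * ∫⁻ x in Ω, ‖f x‖ₑ ^ q := by
  let cells : {k : Fin n → ℤ // smallCell a b ε k ⊆ Ω} → Set (Eucl n) :=
    fun k => smallCell a b ε k.1
  have hcells : Pairwise (Function.onFun Disjoint cells) := by
    intro k l hkl
    refine Set.disjoint_left.2 fun x hx hx' => hkl (Subtype.ext ?_)
    have h1 : cellIndex a b ε x = k.1 := smallCell_subset_cellIndex_fiber hab hε hx
    have h2 : cellIndex a b ε x = l.1 := smallCell_subset_cellIndex_fiber hab hε hx'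
    exact h1.symm.trans h2
  have hfiber (k : Fin n → ℤ) :
      ∫⁻ p in {x | cellIndex a b ε x = k} ×ˢ refCell a b, ‖twoScale Ω a b ε f p‖ₑ ^ q =
        Set.indicator {k | smallCell a b ε k ⊆ Ω} (fun k => volume (halfOpenCell a b) *
          ∫⁻ x in smallCell a b ε k, ‖f x‖ₑ ^ q) k := by
    have hmeas : MeasurableSet ({x | cellIndex a b ε x = k} ×ˢ refCell a b) :=
      measurableSet_cellIndex_fiber.prod isOpen_refCell.measurableSet
    by_cases hk : smallCell a b ε k ⊆ Ω
    · rw [Set.indicator_of_mem (by exact hk)]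
      have h1 := aestronglyMeasurable_comp_cellHomeomorph (a := a) (b := b) hε (hf.mono_set hk)
      rw [setLIntegral_congr_fun hmeas
        (g := fun p => ‖f (cellHomeomorph a b k hε p.2)‖ₑ ^ q)
        fun p hp => by rw [twoScale_of_subset hε hk hp.1]]
      rw [Measure.volume_eq_prod, ← Measure.prod_restrict,
        ← lintegral_map' (f := fun y => ‖f (cellHomeomorph a b k hε y)‖ₑ ^ q) (g := Prod.snd)
          ?_ measurable_snd.aemeasurable, Measure.map_snd_prod, lintegral_smul_measure,
        lintegral_refCell_comp_cellHomeomorph hε k fun z => ‖f z‖ₑ ^ q,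
        Measure.restrict_apply_univ, smul_eq_mul, ← mul_assoc,
        mul_comm (volume _), volume_cellIndex_fiber hab hε]
      rw [Measure.map_snd_prod]
      exact (h1.enorm.pow_const q).smul_measure _
    · rw [Set.indicator_of_notMem (by exact hk),
        setLIntegral_congr_fun hmeas (g := fun _ => 0) fun p hp => by
          rw [twoScale_of_not_subset hk hp.1, enorm_zero, ENNReal.zero_rpow_of_pos hq]]
      simp
  calc ∫⁻ p in Ω ×ˢ refCell a b, ‖twoScale Ω a b ε f p‖ₑ ^ q
      ≤ ∫⁻ p in Set.univ ×ˢ refCell a b, ‖twoScale Ω a b ε f p‖ₑ ^ q :=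
        lintegral_mono_set (Set.prod_mono_left (Set.subset_univ _))
    _ ≤ ∑' k, ∫⁻ p in {x | cellIndex a b ε x = k} ×ˢ refCell a b,
          ‖twoScale Ω a b ε f p‖ₑ ^ q := by
        rw [← iUnion_cellIndex_fiber_prod (a := a) (b := b) (ε := ε)]
        exact lintegral_iUnion_le _ _
    _ = volume (halfOpenCell a b) * ∑' k, ∫⁻ x in cells k, ‖f x‖ₑ ^ q := by
        simp only [hfiber]
        rw [← tsum_subtype, ENNReal.tsum_mul_left]
        rfl
    _ = volume (halfOpenCell a b) * ∫⁻ x in ⋃ k, cells k, ‖f x‖ₑ ^ q := by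
        rw [lintegral_iUnion (fun k => measurableSet_smallCell hε) hcells]
    _ ≤ _ := by
        gcongr
        exact Set.iUnion_subset fun k => k.2

theorem eLpNorm_twoScale_le (hab : ∀ j, a j < b j) (hε : ε ≠ 0) {Ω : Set (Eucl n)}
    {f : Eucl n → F} (hf : AEStronglyMeasurable f (volume.restrict Ω)) :
    eLpNorm (twoScale Ω a b ε f) 2 (volume.restrict (Ω ×ˢ refCell a b)) ≤
      volume (halfOpenCell a b) ^ (1 / 2 : ℝ) * eLpNorm f 2 (volume.restrict Ω) := by
  rw [eLpNorm_eq_lintegral_rpow_enorm_toReal two_ne_zero ENNReal.ofNat_ne_top,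
    eLpNorm_eq_lintegral_rpow_enorm_toReal two_ne_zero ENNReal.ofNat_ne_top,
    ENNReal.toReal_ofNat, ← ENNReal.mul_rpow_of_nonneg _ _ (by norm_num)]
  exact ENNReal.rpow_le_rpow (lintegral_twoScale_le hab hε hf two_pos) (by norm_num)

theorem memLp_twoScale (hab : ∀ j, a j < b j) (hε : ε ≠ 0) {Ω : Set (Eucl n)}
    {f : Eucl n → F} (hf : MemLp f 2 (volume.restrict Ω)) :
    MemLp (twoScale Ω a b ε f) 2 (volume.restrict (Ω ×ˢ refCell a b)) :=
  ⟨aestronglyMeasurable_twoScale hε hf.1, (eLpNorm_twoScale_le hab hε hf.1).trans_lt <|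
    ENNReal.mul_lt_top (ENNReal.rpow_lt_top_of_nonneg (by norm_num)
      volume_halfOpenCell_lt_top.ne) hf.2⟩

end TwoScale

/-! ### Integration by parts in `y` for each term of the expansion -/

section IntegrationByParts

variable {n : ℕ}

instance isAddHaarMeasure_volume_prod_eucl :
    (volume : Measure (Eucl n × Eucl n)).IsAddHaarMeasure :=
  inferInstanceAs ((volume : Measure (Eucl n)).prod (volume : Measure (Eucl n))).IsAddHaarMeasure

theorem contDiff_fderiv_apply {E : Type*} [NormedAddCommGroup E] [NormedSpace ℝ E] {φ : E → ℝ}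
    (hφ : ContDiff ℝ ∞ φ) (e : E) : ContDiff ℝ ∞ fun x => fderiv ℝ φ x e :=
  (hφ.fderiv_right (m := ∞) (by simp)).clm_apply contDiff_const

/-- Integration by parts in the second variable, from integration by parts on the fibres. -/
theorem setIntegral_prod_mul_fderiv_snd {U Y : Set (Eucl n)} (hU : IsOpen U)
    (hUb : Bornology.IsBounded U) (hY : IsOpen Y) (hYb : Bornology.IsBounded Y)
    {f g : Eucl n × Eucl n → ℝ} {e : Eucl n}
    (hf : IntegrableOn f (U ×ˢ Y)) (hg : IntegrableOn g (U ×ˢ Y))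
    (h : ∀ x ∈ U, ∀ φ : Eucl n → ℝ, ContDiff ℝ ∞ φ → HasCompactSupport φ → tsupport φ ⊆ Y →
      ∫ y in Y, f (x, y) * fderiv ℝ φ y e = -∫ y in Y, g (x, y) * φ y)
    {φ : Eucl n × Eucl n → ℝ} (hφ : ContDiff ℝ ∞ φ) (hφ0 : ∀ p ∈ frontier (U ×ˢ Y), φ p = 0) :
    ∫ p in U ×ˢ Y, f p * fderiv ℝ φ p (0, e) = -∫ p in U ×ˢ Y, g p * φ p := by
  have hb := hUb.prod hYb
  have hm := (hU.prod hY).measurableSet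
  have hint1 := integrableOn_mul_of_continuous_of_isBounded hb hm hf
    (contDiff_fderiv_apply hφ (0, e)).continuous
  have hint2 := integrableOn_mul_of_continuous_of_isBounded hb hm hg hφ.continuous
  rw [Measure.volume_eq_prod] at hint1 hint2 hf hg ⊢
  rw [setIntegral_prod _ hint1, setIntegral_prod _ hint2, ← integral_neg]
  rw [IntegrableOn, ← Measure.prod_restrict] at hf hg
  refine integral_congr_ae ?_
  filter_upwards [ae_restrict_mem hU.measurableSet, hf.prod_right_ae, hg.prod_right_ae]
    with x hx hfx hgx
  have hφx : ContDiff ℝ ∞ fun y => φ (x, y) := hφ.comp (contDiff_prodMk_right x)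
  have hd (y : Eucl n) : fderiv ℝ (fun y => φ (x, y)) y e = fderiv ℝ φ (x, y) (0, e) := by
    have h1 := (hφ.differentiable (by simp)).differentiableAt (x := (x, y)) |>.hasFDerivAt
    have h2 : fderiv ℝ (fun y => φ (x, y)) y = _ := (h1.comp y (hasFDerivAt_prodMk_right x y)).fderiv
    simp [h2]
  -- For `x ∈ U` and `y` on the frontier of `Y`, the point `(x, y)` is on the frontier of the
  -- product, so the slice of `φ` vanishes on the frontier of `Y`.
  have := setIntegral_mul_fderiv_of_eq_zero_on_frontier hY hYb hfx hgx (h x hx) hφx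
    fun y hy => hφ0 _ (by
      rw [frontier_prod_eq]
      exact Or.inl ⟨subset_closure hx, hy⟩)
  simpa only [hd] using this

/-- Classical integration by parts against a compactly supported function in an open set. -/
theorem setIntegral_mul_fderiv_of_contDiff {Y : Set (Eucl n)} {f φ : Eucl n → ℝ}
    (hf : ContDiff ℝ 1 f) (hφ : ContDiff ℝ ∞ φ) (hφc : HasCompactSupport φ)
    (hφs : tsupport φ ⊆ Y) (e : Eucl n) :
    ∫ y in Y, f y * fderiv ℝ φ y e = -∫ y in Y, fderiv ℝ f y e * φ y := by
  have hf' : Continuous fun y => fderiv ℝ f y e :=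
    (hf.continuous_fderiv one_ne_zero).clm_apply continuous_const
  have hφ' := (contDiff_fderiv_apply hφ e).continuous
  rw [setIntegral_eq_integral_of_forall_compl_eq_zero fun y hy => ?_,
    setIntegral_eq_integral_of_forall_compl_eq_zero fun y hy => ?_]
  · refine integral_mul_fderiv_eq_neg_fderiv_mul_of_integrable ?_ ?_ ?_
      (fun x _ => hf.differentiable one_ne_zero x) (fun x _ => hφ.differentiable (by simp) x)
    · exact (hf'.mul hφ.continuous).integrable_of_hasCompactSupport hφc.mul_left
    · exact (hf.continuous.mul hφ').integrable_of_hasCompactSupport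
        (hφc.fderiv_apply ℝ e).mul_left
    · exact (hf.continuous.mul hφ.continuous).integrable_of_hasCompactSupport hφc.mul_left
  · rw [image_eq_zero_of_notMem_tsupport fun h => hy (hφs h), mul_zero]
  · rw [(notMem_tsupport_iff_eventuallyEq.1 fun h => hy (hφs h)).fderiv_eq]
    simp

theorem memLp_integrableOn_of_isBounded {E F : Type*} [NormedAddCommGroup E] [NormedSpace ℝ E]
    [FiniteDimensional ℝ E] [MeasurableSpace E] [BorelSpace E] [NormedAddCommGroup F]
    {μ : Measure E} [IsFiniteMeasureOnCompacts μ] {U : Set E} (hU : Bornology.IsBounded U)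
    {f : E → F} (hf : MemLp f 2 (μ.restrict U)) : IntegrableOn f U μ := by
  have : IsFiniteMeasure (μ.restrict U) := ⟨by
    rw [Measure.restrict_apply_univ]
    exact hU.measure_lt_top⟩
  exact hf.integrable one_le_two

/-- A square integrable function of the first variable is square integrable on a product. -/
theorem memLp_comp_fst {F : Type*} [NormedAddCommGroup F] {U Y : Set (Eucl n)}
    (hYb : Bornology.IsBounded Y) {f : Eucl n → F} (hf : MemLp f 2 (volume.restrict U)) :
    MemLp (fun p : Eucl n × Eucl n => f p.1) 2 (volume.restrict (U ×ˢ Y)) := by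
  have : IsFiniteMeasure (volume.restrict Y) := ⟨by
    rw [Measure.restrict_apply_univ]
    exact hYb.measure_lt_top⟩
  rw [Measure.volume_eq_prod, ← Measure.prod_restrict]
  exact hf.comp_fst _

variable {Ω : Set (Eucl n)} {a b : Fin n → ℝ}

theorem setIntegral_twoScale_mul_fderiv (hΩ : IsOpen Ω) (hΩb : Bornology.IsBounded Ω)
    (hab : ∀ j, a j < b j) {ε : ℝ} (hε : ε ≠ 0) {u : Eucl n → ℝ} {Du : Eucl n → Eucl n}
    (hu : IsH1With Ω u Du) (e : Eucl n) {φ : Eucl n × Eucl n → ℝ} (hφ : ContDiff ℝ ∞ φ)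
    (hφ0 : ∀ p ∈ frontier (Ω ×ˢ refCell a b), φ p = 0) :
    ∫ p in Ω ×ˢ refCell a b, twoScale Ω a b ε u p * fderiv ℝ φ p (0, e) =
      -∫ p in Ω ×ˢ refCell a b, ε * ⟪twoScale Ω a b ε Du p, e⟫ * φ p := by
  have hb := hΩb.prod (isBounded_refCell (a := a) (b := b))
  refine setIntegral_prod_mul_fderiv_snd hΩ hΩb isOpen_refCell isBounded_refCell
    (memLp_integrableOn_of_isBounded hb (memLp_twoScale hab hε hu.1))
    (((memLp_integrableOn_of_isBounded hb (memLp_twoScale hab hε hu.2.1)).inner_const e).const_mul ε)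
    ?_ hφ hφ0
  -- With `x` fixed the cell index is fixed, so only one cell, kept or discarded, is involved.
  intro x _ ψ hψ hψc hψs
  by_cases hk : smallCell a b ε (cellIndex a b ε x) ⊆ Ω
  · simp only [twoScale_of_subset hε hk (p := (x, _)) rfl]
    exact setIntegral_comp_cellHomeomorph_mul_fderiv hε hΩ.measurableSet hk hu.2.2 hψ hψc hψs e
  · simp [twoScale_of_not_subset hk (p := (x, _)) rfl]

theorem setIntegral_comp_fst_mul_fderiv (hΩ : IsOpen Ω) (hΩb : Bornology.IsBounded Ω)
    {f : Eucl n → ℝ} (hf : MemLp f 2 (volume.restrict Ω)) (e : Eucl n)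
    {φ : Eucl n × Eucl n → ℝ} (hφ : ContDiff ℝ ∞ φ)
    (hφ0 : ∀ p ∈ frontier (Ω ×ˢ refCell a b), φ p = 0) :
    ∫ p in Ω ×ˢ refCell a b, f p.1 * fderiv ℝ φ p (0, e) = 0 := by
  have hb := hΩb.prod (isBounded_refCell (a := a) (b := b))
  rw [setIntegral_prod_mul_fderiv_snd hΩ hΩb isOpen_refCell isBounded_refCell (g := fun _ => 0)
    (memLp_integrableOn_of_isBounded hb (memLp_comp_fst isBounded_refCell hf))
    integrableOn_zero ?_ hφ hφ0]
  · simp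
  intro x _ ψ hψ hψc hψs
  simpa using setIntegral_mul_fderiv_of_contDiff (contDiff_const (c := f x)) hψ hψc hψs e

theorem memLp_inner_snd (hΩ : IsOpen Ω) {f : Eucl n → Eucl n}
    (hf : MemLp f 2 (volume.restrict Ω)) :
    MemLp (fun p : Eucl n × Eucl n => ⟪p.2, f p.1⟫) 2 (volume.restrict (Ω ×ˢ refCell a b)) := by
  obtain ⟨C, hC⟩ := (isBounded_refCell (a := a) (b := b)).exists_norm_le
  have h := memLp_comp_fst (isBounded_refCell (a := a) (b := b)) hf
  refine (h.const_smul C).mono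
    (continuous_snd.aestronglyMeasurable.inner h.1) ?_
  filter_upwards [ae_restrict_mem (hΩ.prod isOpen_refCell).measurableSet] with p hp
  refine (norm_inner_le_norm _ _).trans ?_
  rw [Pi.smul_apply, norm_smul]
  gcongr
  exact (hC _ hp.2).trans (le_abs_self _)

theorem setIntegral_inner_snd_mul_fderiv (hΩ : IsOpen Ω) (hΩb : Bornology.IsBounded Ω)
    {f : Eucl n → Eucl n} (hf : MemLp f 2 (volume.restrict Ω)) (e : Eucl n)
    {φ : Eucl n × Eucl n → ℝ} (hφ : ContDiff ℝ ∞ φ)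
    (hφ0 : ∀ p ∈ frontier (Ω ×ˢ refCell a b), φ p = 0) :
    ∫ p in Ω ×ˢ refCell a b, ⟪p.2, f p.1⟫ * fderiv ℝ φ p (0, e) =
      -∫ p in Ω ×ˢ refCell a b, ⟪f p.1, e⟫ * φ p := by
  have hb := hΩb.prod (isBounded_refCell (a := a) (b := b))
  refine setIntegral_prod_mul_fderiv_snd hΩ hΩb isOpen_refCell isBounded_refCell
    (memLp_integrableOn_of_isBounded hb (memLp_inner_snd hΩ hf))
    ((memLp_integrableOn_of_isBounded hb (memLp_comp_fst isBounded_refCell hf)).inner_const e)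
    ?_ hφ hφ0
  intro x _ ψ hψ hψc hψs
  have hd (y : Eucl n) : fderiv ℝ (fun y : Eucl n => ⟪y, f x⟫) y e = ⟪f x, e⟫ := by
    have h1 : fderiv ℝ (fun y : Eucl n => ⟪y, f x⟫) y e = _ :=
      fderiv_inner_apply ℝ differentiableAt_id (differentiableAt_const _) e
    simp [h1, real_inner_comm]
  have := setIntegral_mul_fderiv_of_contDiff (f := fun y : Eucl n => ⟪y, f x⟫)
    (contDiff_id.inner ℝ contDiff_const)
    hψ hψc hψs e
  simpa only [hd] using this

/-- The weak gradient of `u¹` is defined by test functions of the pair `(x, y)`, so the truncation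
argument is applied on the product itself and not on the fibres. -/
theorem setIntegral_mul_fderiv_of_isL2H1PerWith (hΩ : IsOpen Ω) (hΩb : Bornology.IsBounded Ω)
    {f : Eucl n × Eucl n → ℝ} {g : Eucl n × Eucl n → Eucl n} (hf : IsL2H1PerWith Ω a b f g)
    (e : Eucl n) {φ : Eucl n × Eucl n → ℝ} (hφ : ContDiff ℝ ∞ φ)
    (hφ0 : ∀ p ∈ frontier (Ω ×ˢ refCell a b), φ p = 0) :
    ∫ p in Ω ×ˢ refCell a b, f p * fderiv ℝ φ p (0, e) =
      -∫ p in Ω ×ˢ refCell a b, ⟪g p, e⟫ * φ p := by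
  have hb := hΩb.prod (isBounded_refCell (a := a) (b := b))
  obtain ⟨-, hf2, hg2, -, -, hw⟩ := hf
  refine setIntegral_mul_fderiv_of_eq_zero_on_frontier (hΩ.prod isOpen_refCell) hb
    (memLp_integrableOn_of_isBounded hb hf2)
    ((memLp_integrableOn_of_isBounded hb hg2).inner_const e) ?_ hφ hφ0
  intro ψ hψ hψc hψs
  have hsub : Ω ×ˢ refCell a b ⊆ Ω ×ˢ Set.univ := Set.prod_mono_right (Set.subset_univ _)
  have hm : MeasurableSet (Ω ×ˢ (Set.univ : Set (Eucl n))) := (hΩ.prod isOpen_univ).measurableSet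
  have hψ0 (p) (hp : p ∈ (Ω ×ˢ Set.univ) \ (Ω ×ˢ refCell a b)) : p ∉ tsupport ψ :=
    fun h => hp.2 (hψs h)
  have h := hw ψ hψ hψc (hψs.trans hsub) e
  rwa [setIntegral_eq_of_subset_of_forall_sdiff_eq_zero hm hsub fun p hp => by
      simp [(notMem_tsupport_iff_eventuallyEq.1 (hψ0 p hp)).fderiv_eq],
    setIntegral_eq_of_subset_of_forall_sdiff_eq_zero hm hsub fun p hp => by
      simp [image_eq_zero_of_notMem_tsupport (hψ0 p hp)]] at h

end IntegrationByParts

/-! ### Weak convergence of bounded families from a total set -/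

section WeakConvergence

/-- A bounded family in a Hilbert space converges weakly as soon as it converges when tested
against a total set. -/
theorem tendsto_inner_of_forall_mem_total {H : Type*} [NormedAddCommGroup H]
    [InnerProductSpace ℝ H] [CompleteSpace H] {ι : Type*} {l : Filter ι} {x : ι → H} {x₀ : H}
    {C : ℝ} (hC : ∀ᶠ i in l, ‖x i‖ ≤ C) {S : Set H} (hS : ∀ w : H, (∀ s ∈ S, ⟪s, w⟫ = 0) → w = 0)
    (h : ∀ s ∈ S, Tendsto (fun i => ⟪x i, s⟫) l (𝓝 ⟪x₀, s⟫)) (w : H) :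
    Tendsto (fun i => ⟪x i, w⟫) l (𝓝 ⟪x₀, w⟫) := by
  have hspan (v : H) (hv : v ∈ Submodule.span ℝ S) :
      Tendsto (fun i => ⟪x i, v⟫) l (𝓝 ⟪x₀, v⟫) := by
    induction hv using Submodule.span_induction with
    | mem v hv => exact h v hv
    | zero => simpa only [inner_zero_right] using tendsto_const_nhds
    | add v w _ _ hv hw => simpa only [inner_add_right] using hv.add hw
    | smul c v _ hv => simpa only [inner_smul_right] using hv.const_mul c
  have hdense : (Submodule.span ℝ S).topologicalClosure = ⊤ := by
    rw [Submodule.topologicalClosure_eq_top_iff, Submodule.eq_bot_iff]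
    exact fun w hw => hS w fun s hs => hw s (Submodule.subset_span hs)
  rw [Metric.tendsto_nhds]
  intro δ hδ
  -- An eventual bound for `‖x i - x₀‖`; the summand `1` keeps it positive for the division by `M`.
  set M := |C| + ‖x₀‖ + 1
  have hM : 0 < M := by positivity
  have hw : w ∈ closure (Submodule.span ℝ S : Set H) := by
    rw [← Submodule.topologicalClosure_coe, hdense]
    trivial
  obtain ⟨v, hv, hvw⟩ := Metric.mem_closure_iff.1 hw (δ / 2 / M) (by positivity)
  filter_upwards [hC, Metric.tendsto_nhds.1 (hspan v hv) (δ / 2) (by positivity)] with i hi hi'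
  rw [Real.dist_eq, ← inner_sub_left] at hi' ⊢
  have hD : ‖x i - x₀‖ ≤ M := by
    linarith [norm_sub_le (x i) x₀, le_abs_self C]
  have hsplit : ⟪x i - x₀, w⟫ = ⟪x i - x₀, w - v⟫ + ⟪x i - x₀, v⟫ := by
    rw [← inner_add_right, sub_add_cancel]
  have h1 : |⟪x i - x₀, w - v⟫| ≤ δ / 2 := by
    refine (abs_real_inner_le_norm _ _).trans ?_
    calc ‖x i - x₀‖ * ‖w - v‖ ≤ M * (δ / 2 / M) := by
          rw [dist_eq_norm] at hvw
          gcongr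
      _ = δ / 2 := by field_simp
  rw [hsplit]
  linarith [abs_add_le ⟪x i - x₀, w - v⟫ ⟪x i - x₀, v⟫]

theorem inner_toLp_toLp {α F : Type*} [MeasurableSpace α] {μ : Measure α} [NormedAddCommGroup F]
    [InnerProductSpace ℝ F] {f g : α → F} (hf : MemLp f 2 μ) (hg : MemLp g 2 μ) :
    ⟪hf.toLp f, hg.toLp g⟫ = ∫ x, ⟪f x, g x⟫ ∂μ := by
  rw [L2.inner_def]
  refine integral_congr_ae ?_
  filter_upwards [hf.coeFn_toLp, hg.coeFn_toLp] with x hx hx'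
  rw [hx, hx']

/-- A bounded family in `L²(U; F)` converges weakly as soon as it converges when tested against
compactly supported smooth fields. -/
theorem tendsto_setIntegral_inner_of_contDiff {E F : Type*} [NormedAddCommGroup E]
    [NormedSpace ℝ E] [FiniteDimensional ℝ E] [MeasurableSpace E] [BorelSpace E]
    [NormedAddCommGroup F] [InnerProductSpace ℝ F] [CompleteSpace F]
    {μ : Measure E} [IsFiniteMeasureOnCompacts μ] {U : Set E} (hU : IsOpen U)
    (hUb : Bornology.IsBounded U) {ι : Type*} {l : Filter ι} {f : ι → E → F} {f₀ : E → F}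
    (hf : ∀ i, MemLp (f i) 2 (μ.restrict U)) (hf₀ : MemLp f₀ 2 (μ.restrict U))
    {C : NNReal} (hC : ∀ᶠ i in l, eLpNorm (f i) 2 (μ.restrict U) ≤ C)
    (h : ∀ φ : E → ℝ, ContDiff ℝ ∞ φ → HasCompactSupport φ → tsupport φ ⊆ U → ∀ c : F,
      Tendsto (fun i => ∫ x in U, ⟪f i x, φ x • c⟫ ∂μ) l (𝓝 (∫ x in U, ⟪f₀ x, φ x • c⟫ ∂μ)))
    {w : E → F} (hw : MemLp w 2 (μ.restrict U)) :
    Tendsto (fun i => ∫ x in U, ⟪f i x, w x⟫ ∂μ) l (𝓝 (∫ x in U, ⟪f₀ x, w x⟫ ∂μ)) := by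
  have htest {φ : E → ℝ} (hφ : ContDiff ℝ ∞ φ) (hφc : HasCompactSupport φ) (c : F) :
      MemLp (fun x => φ x • c) 2 (μ.restrict U) :=
    (hφ.continuous.smul continuous_const).memLp_of_hasCompactSupport hφc.smul_right
  let S : Set (Lp F 2 (μ.restrict U)) := {s | ∃ (φ : E → ℝ) (hφ : ContDiff ℝ ∞ φ)
    (hφc : HasCompactSupport φ) (_ : tsupport φ ⊆ U) (c : F), s = (htest hφ hφc c).toLp _}
  have hS (g : Lp F 2 (μ.restrict U)) (hg : ∀ s ∈ S, ⟪s, g⟫ = 0) : g = 0 := by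
    have hgm : MemLp g 2 (μ.restrict U) := Lp.memLp g
    have hgi : IntegrableOn g U μ := memLp_integrableOn_of_isBounded hUb hgm
    have h0 : ∀ᵐ x ∂μ, x ∈ U → g x = 0 := by
      -- Totality of the fields `φ • c` is the fundamental lemma of the calculus of variations; the
      -- vectors `c` detect each value of the vector integral.
      refine hU.ae_eq_zero_of_integral_contDiff_smul_eq_zero hgi.locallyIntegrableOn ?_
      intro φ hφ hφc hφs
      rw [← setIntegral_eq_integral_of_forall_compl_eq_zero (s := U) fun x hx => by
        rw [image_eq_zero_of_notMem_tsupport fun h => hx (hφs h), zero_smul]]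
      refine ext_inner_left ℝ fun c => ?_
      obtain ⟨K, hK⟩ := hφc.exists_bound_of_continuous hφ.continuous
      have hint : IntegrableOn (fun x => φ x • g x) U μ :=
        hgi.bdd_smul K hφ.continuous.aestronglyMeasurable (Eventually.of_forall hK)
      have h1 := hg _ ⟨φ, hφ, hφc, hφs, c, rfl⟩
      rw [← Lp.toLp_coeFn g hgm, inner_toLp_toLp] at h1
      rw [← integral_inner hint, inner_zero_right, ← h1]
      simp only [inner_smul_left, inner_smul_right, RCLike.conj_to_real]
    rw [Lp.eq_zero_iff_ae_eq_zero]
    exact (ae_restrict_iff' hU.measurableSet).2 h0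
  have key := tendsto_inner_of_forall_mem_total (l := l) (x := fun i => (hf i).toLp (f i))
    (x₀ := hf₀.toLp f₀) (C := C) (S := S) ?_ hS ?_ (hw.toLp w)
  · simpa only [inner_toLp_toLp] using key
  · filter_upwards [hC] with i hi
    rw [Lp.norm_toLp]
    exact ENNReal.toReal_le_coe_of_le_coe hi
  · rintro _ ⟨φ, hφ, hφc, hφs, c, rfl⟩
    simpa only [inner_toLp_toLp] using h φ hφ hφc hφs c

end WeakConvergence

/-! ### The exact identity for the defect -/

section MainIdentity

variable {n : ℕ} {Ω : Set (Eucl n)} {a b : Fin n → ℝ}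

/-- The defect of `T(∇u)` from its limit, tested against a scalar function that vanishes on the
boundary, is given by the first-order remainder. -/
theorem setIntegral_twoScale_sub_eq (hΩ : IsOpen Ω) (hΩb : Bornology.IsBounded Ω)
    (hab : ∀ j, a j < b j) {ε : ℝ} (hε : ε ≠ 0) {u u0 : Eucl n → ℝ} {Du Du0 : Eucl n → Eucl n}
    (hu : IsH1With Ω u Du) (hu0 : IsH1With Ω u0 Du0)
    {u1 : Eucl n × Eucl n → ℝ} {Du1 : Eucl n × Eucl n → Eucl n}
    (hu1 : IsL2H1PerWith Ω a b u1 Du1) (e : Eucl n) {φ : Eucl n × Eucl n → ℝ}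
    (hφ : ContDiff ℝ ∞ φ) (hφ0 : ∀ p ∈ frontier (Ω ×ˢ refCell a b), φ p = 0) :
    (∫ p in Ω ×ˢ refCell a b, ⟪twoScale Ω a b ε Du p, e⟫ * φ p) -
      ∫ p in Ω ×ˢ refCell a b, ⟪Du0 p.1 + Du1 p, e⟫ * φ p =
      -∫ p in Ω ×ˢ refCell a b,
        firstOrderRemainder Ω a b ε u u0 Du0 u1 p * fderiv ℝ φ p (0, e) := by
  have hb := hΩb.prod (isBounded_refCell (a := a) (b := b))
  have hm := (hΩ.prod (isOpen_refCell (a := a) (b := b))).measurableSet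
  have hφ' := (contDiff_fderiv_apply hφ (0, e)).continuous
  have hint {f : Eucl n × Eucl n → ℝ} (hf : MemLp f 2 (volume.restrict (Ω ×ˢ refCell a b))) :=
    integrableOn_mul_of_continuous_of_isBounded hb hm (memLp_integrableOn_of_isBounded hb hf) hφ'
  have hint' {f : Eucl n × Eucl n → Eucl n}
      (hf : MemLp f 2 (volume.restrict (Ω ×ˢ refCell a b))) :=
    integrableOn_mul_of_continuous_of_isBounded hb hm
      ((memLp_integrableOn_of_isBounded hb hf).inner_const (𝕜 := ℝ) e) hφ.continuous
  have i1 := hint (memLp_twoScale hab hε hu.1)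
  have i2 := hint (memLp_comp_fst isBounded_refCell hu0.1)
  have i3 := hint hu1.2.1
  have i4 := hint (memLp_inner_snd hΩ hu0.2.1)
  have e1 := setIntegral_twoScale_mul_fderiv hΩ hΩb hab hε hu e hφ hφ0
  have e2 := setIntegral_comp_fst_mul_fderiv hΩ hΩb hu0.1 e hφ hφ0
  have e3 := setIntegral_mul_fderiv_of_isL2H1PerWith hΩ hΩb hu1 e hφ hφ0
  have e4 := setIntegral_inner_snd_mul_fderiv hΩ hΩb hu0.2.1 e hφ hφ0
  have hr (p : Eucl n × Eucl n) :
      firstOrderRemainder Ω a b ε u u0 Du0 u1 p * fderiv ℝ φ p (0, e) =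
        ε⁻¹ * (twoScale Ω a b ε u p * fderiv ℝ φ p (0, e)) -
          ε⁻¹ * (u0 p.1 * fderiv ℝ φ p (0, e)) - u1 p * fderiv ℝ φ p (0, e) -
          ⟪p.2, Du0 p.1⟫ * fderiv ℝ φ p (0, e) := by
    simp only [firstOrderRemainder]
    field_simp
  simp only [hr, inner_add_left, add_mul]
  rw [integral_sub ?_ i4, integral_sub ?_ i3, integral_sub (i1.const_mul _) (i2.const_mul _),
    integral_const_mul, integral_const_mul, e1, e2, e3, e4,
    integral_add (hint' (memLp_comp_fst isBounded_refCell hu0.2.1)) (hint' hu1.2.2.1)]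
  · simp only [mul_assoc, integral_const_mul]
    field_simp
    ring
  · exact (i1.const_mul _).sub (i2.const_mul _)
  · exact ((i1.const_mul _).sub (i2.const_mul _)).sub i3

/-- The divergence of a field in the second variable. -/
noncomputable def divSnd (v : Eucl n × Eucl n → Eucl n) (p : Eucl n × Eucl n) : ℝ :=
  ∑ j, fderiv ℝ (fun q => v q j) p (0, EuclideanSpace.single j 1)

theorem contDiff_apply_eucl {v : Eucl n × Eucl n → Eucl n} (hv : ContDiff ℝ ∞ v) (j : Fin n) :
    ContDiff ℝ ∞ fun p => v p j :=
  (EuclideanSpace.proj (𝕜 := ℝ) j).contDiff.comp hv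

theorem contDiff_divSnd {v : Eucl n × Eucl n → Eucl n} (hv : ContDiff ℝ ∞ v) :
    ContDiff ℝ ∞ (divSnd v) :=
  ContDiff.sum fun j _ => contDiff_fderiv_apply (contDiff_apply_eucl hv j) _

theorem memLp_firstOrderRemainder (hΩ : IsOpen Ω) (hab : ∀ j, a j < b j) {ε : ℝ} (hε : ε ≠ 0)
    {u u0 : Eucl n → ℝ} {Du Du0 : Eucl n → Eucl n}
    (hu : IsH1With Ω u Du) (hu0 : IsH1With Ω u0 Du0)
    {u1 : Eucl n × Eucl n → ℝ} {Du1 : Eucl n × Eucl n → Eucl n}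
    (hu1 : IsL2H1PerWith Ω a b u1 Du1) :
    MemLp (firstOrderRemainder Ω a b ε u u0 Du0 u1) 2 (volume.restrict (Ω ×ˢ refCell a b)) :=
  ((((memLp_twoScale hab hε hu.1).sub (memLp_comp_fst isBounded_refCell hu0.1)).sub
    (hu1.2.1.const_mul ε)).sub ((memLp_inner_snd hΩ hu0.2.1).const_mul ε)).const_mul ε⁻¹

/-- The defect of `T(∇u)` from its limit, tested against a field that vanishes on the boundary. -/
theorem setIntegral_inner_twoScale_sub_eq (hΩ : IsOpen Ω) (hΩb : Bornology.IsBounded Ω)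
    (hab : ∀ j, a j < b j) {ε : ℝ} (hε : ε ≠ 0) {u u0 : Eucl n → ℝ} {Du Du0 : Eucl n → Eucl n}
    (hu : IsH1With Ω u Du) (hu0 : IsH1With Ω u0 Du0)
    {u1 : Eucl n × Eucl n → ℝ} {Du1 : Eucl n × Eucl n → Eucl n}
    (hu1 : IsL2H1PerWith Ω a b u1 Du1) {v : Eucl n × Eucl n → Eucl n}
    (hv : ContDiff ℝ ∞ v) (hv0 : ∀ p ∈ frontier (Ω ×ˢ refCell a b), v p = 0) :
    (∫ p in Ω ×ˢ refCell a b, ⟪twoScale Ω a b ε Du p, v p⟫) -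
      ∫ p in Ω ×ˢ refCell a b, ⟪Du0 p.1 + Du1 p, v p⟫ =
      -∫ p in Ω ×ˢ refCell a b, firstOrderRemainder Ω a b ε u u0 Du0 u1 p * divSnd v p := by
  have hb := hΩb.prod (isBounded_refCell (a := a) (b := b))
  have hm := (hΩ.prod (isOpen_refCell (a := a) (b := b))).measurableSet
  have hsum {f : Eucl n × Eucl n → Eucl n}
      (hf : MemLp f 2 (volume.restrict (Ω ×ˢ refCell a b))) :
      ∫ p in Ω ×ˢ refCell a b, ⟪f p, v p⟫ =
        ∑ j, ∫ p in Ω ×ˢ refCell a b, ⟪f p, EuclideanSpace.single j 1⟫ * v p j := by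
    rw [← integral_finsetSum _ fun j _ => integrableOn_mul_of_continuous_of_isBounded hb hm
      ((memLp_integrableOn_of_isBounded hb hf).inner_const _)
      (contDiff_apply_eucl hv j).continuous]
    refine integral_congr_ae (Eventually.of_forall fun p => ?_)
    simp [PiLp.inner_apply, mul_comm]
  have hr := memLp_integrableOn_of_isBounded hb (memLp_firstOrderRemainder hΩ hab hε hu hu0 hu1)
  rw [hsum (memLp_twoScale hab hε hu.2.1),
    hsum (f := fun p => Du0 p.1 + Du1 p)
      ((memLp_comp_fst isBounded_refCell hu0.2.1).add hu1.2.2.1), ← Finset.sum_sub_distrib]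
  simp only [divSnd, Finset.mul_sum]
  rw [integral_finsetSum _ fun j _ => integrableOn_mul_of_continuous_of_isBounded hb hm hr
    (contDiff_fderiv_apply (contDiff_apply_eucl hv j) _).continuous, ← Finset.sum_neg_distrib]
  -- The identity is linear in `v`, so it reduces to the scalar one for each coordinate direction.
  refine Finset.sum_congr rfl fun j _ => ?_
  exact setIntegral_twoScale_sub_eq hΩ hΩb hab hε hu hu0 hu1 _ (contDiff_apply_eucl hv j)
    fun p hp => by simp [hv0 p hp]

end MainIdentity

/-! ### The theorem -/

theorem mainTheorem1 {n : ℕ} (Ω : Set (Eucl n)) (hΩ : IsOpen Ω) (hΩb : Bornology.IsBounded Ω)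
    (a b : Fin n → ℝ) (hab : ∀ j, a j < b j)
    {ι : Type*} (l : Filter ι) (ε : ι → ℝ) (hεpos : ∀ i, 0 < ε i) (hε : Tendsto ε l (𝓝 0))
    (u : ι → Eucl n → ℝ) (Du : ι → Eucl n → Eucl n) (hu : ∀ i, IsH1With Ω (u i) (Du i))
    (u0 : Eucl n → ℝ) (Du0 : Eucl n → Eucl n) (hu0 : IsH1With Ω u0 Du0)
    (u1 : Eucl n × Eucl n → ℝ) (Du1 : Eucl n × Eucl n → Eucl n)
    (hu1 : IsL2H1PerWith Ω a b u1 Du1)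
    (hzero : VanishesTested (Ω ×ˢ refCell a b) l
      (fun i p => twoScale Ω a b (ε i) (u i) p - u0 p.1))
    (hfirst : VanishesTested (Ω ×ˢ refCell a b) l
      (fun i => firstOrderRemainder Ω a b (ε i) (u i) u0 Du0 u1)) :
    (∀ i, MemLp (twoScale Ω a b (ε i) (Du i)) 2 (volume.restrict (Ω ×ˢ refCell a b))) ∧
    (∀ v : Eucl n × Eucl n → Eucl n, ContDiff ℝ ∞ v →
      (∀ p ∈ frontier (Ω ×ˢ refCell a b), v p = 0) →
      Tendsto (fun i => ∫ p in Ω ×ˢ refCell a b, ⟪twoScale Ω a b (ε i) (Du i) p, v p⟫) l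
        (𝓝 (∫ p in Ω ×ˢ refCell a b, ⟪Du0 p.1 + Du1 p, v p⟫))) ∧
    (BigOTested (Ω ×ˢ refCell a b) l ε
        (fun i => firstOrderRemainder Ω a b (ε i) (u i) u0 Du0 u1) →
      ∀ v : Eucl n × Eucl n → Eucl n, ContDiff ℝ ∞ v →
        (∀ p ∈ frontier (Ω ×ˢ refCell a b), v p = 0) →
        (fun i => (∫ p in Ω ×ˢ refCell a b, ⟪twoScale Ω a b (ε i) (Du i) p, v p⟫) -
          ∫ p in Ω ×ˢ refCell a b, ⟪Du0 p.1 + Du1 p, v p⟫) =O[l] ε) ∧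
    ((∃ C : NNReal, ∀ᶠ i in l, eLpNorm (Du i) 2 (volume.restrict Ω) ≤ C) →
      ∀ w : Eucl n × Eucl n → Eucl n, MemLp w 2 (volume.restrict (Ω ×ˢ refCell a b)) →
        Tendsto (fun i => ∫ p in Ω ×ˢ refCell a b, ⟪twoScale Ω a b (ε i) (Du i) p, w p⟫) l
          (𝓝 (∫ p in Ω ×ˢ refCell a b, ⟪Du0 p.1 + Du1 p, w p⟫))) := by

  have hm := fun i => memLp_twoScale (a := a) (b := b) hab (hεpos i).ne' (hu i).2.1
  have hid := fun i (v : Eucl n × Eucl n → Eucl n) (hv : ContDiff ℝ ∞ v) hv0 =>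
    setIntegral_inner_twoScale_sub_eq hΩ hΩb hab (hεpos i).ne' (hu i) hu0 hu1 hv hv0
  have hlim : ∀ v : Eucl n × Eucl n → Eucl n, ContDiff ℝ ∞ v →
      (∀ p ∈ frontier (Ω ×ˢ refCell a b), v p = 0) →
      Tendsto (fun i => ∫ p in Ω ×ˢ refCell a b, ⟪twoScale Ω a b (ε i) (Du i) p, v p⟫) l
        (𝓝 (∫ p in Ω ×ˢ refCell a b, ⟪Du0 p.1 + Du1 p, v p⟫)) := by
    intro v hv hv0
    rw [← tendsto_sub_nhds_zero_iff]
    simp only [hid _ v hv hv0]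
    simpa using (hfirst _ (contDiff_divSnd hv)).neg
  refine ⟨hm, hlim, fun hO v hv hv0 => ?_, ?_⟩
  · simp only [hid _ v hv hv0]
    exact (hO _ (contDiff_divSnd hv)).neg_left
  · rintro ⟨C, hC⟩ w hw
    have hV : volume (halfOpenCell a b) ^ (1 / 2 : ℝ) * C ≠ ⊤ :=
      ENNReal.mul_ne_top (ENNReal.rpow_ne_top_of_nonneg (by norm_num)
        volume_halfOpenCell_lt_top.ne) ENNReal.coe_ne_top
    refine tendsto_setIntegral_inner_of_contDiff (hΩ.prod isOpen_refCell)
      (hΩb.prod isBounded_refCell) hm ((memLp_comp_fst isBounded_refCell hu0.2.1).add hu1.2.2.1)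
      (C := (volume (halfOpenCell a b) ^ (1 / 2 : ℝ) * C).toNNReal) ?_ ?_ hw
    · filter_upwards [hC] with i hi
      rw [ENNReal.coe_toNNReal hV]
      refine (eLpNorm_twoScale_le hab (hεpos i).ne' (hu i).2.1.1).trans ?_
      gcongr
    · intro φ hφ _ hφs c
      -- The field `φ • c` is admissible in claim 1: its support lies in the open product, which
      -- misses its frontier.
      refine hlim _ (hφ.smul contDiff_const) fun p hp => ?_
      have hp' : p ∉ Ω ×ˢ refCell a b := by
        rw [(hΩ.prod isOpen_refCell).frontier_eq] at hp
        exact hp.2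
      rw [image_eq_zero_of_notMem_tsupport fun h => hp' (hφs h), zero_smul]
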